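/- Let $K$ be a complete discretely valued field with ring of integers $\mathcal O$ and uniformiser $\pi$, let $V$ be a finite-dimensional $K$-vector space, and let $\rho\colon G\to \mathrm{GL}(V)$ be a representation of a group $G$. A lattice in $V$ is a free $\mathcal O$-submodule of rank $d=\dim_K V$; two lattices are homothetic if one is a $K^\times$-multiple of the other. The building $\mathcal X(V)$ of $\mathrm{PGL}(V)$ is the simplicial complex whose vertices are the homothety classes of lattices, vertices $x_0,\dots,x_n$ forming a face if they have representatives with $\pi\Lambda_n\subsetneq\Lambda_0\subsetneq\cdots\subsetneq\Lambda_n$. In its geometric realisation, the apartment attached to a basis $v_1,\dots,v_d$ of $V$ is identified with the Euclidean space $\mathbb R^d/\mathbb R(1,\dots,1)$, the class of $\bigoplus_i\mathcal O\,\pi^{n_i}v_i$ having position $(n_1,\dots,n_d)$ and positions being affine on each simplex. The geodesic $[yz]$ between two points is the straight segment from $y$ to $z$ in any apartment containing both. Let $\mathcal X(\rho)\subseteq\mathcal X(V)$ be the full subcomplex on the vertices represented by $\rho(G)$-invariant lattices. A vertex $x$ of $\mathcal X(\rho)$ is called maximal if there are a nonzero $v\in V$ and a lattice $\Lambda$ representing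 $x$ such that $\Lambda$ is maximal, for inclusion, among the $\rho(G)$-invariant lattices $\Lambda'$ with $v\in\Lambda'\setminus\pi\Lambda'$. Then every maximal vertex $x$ of $\mathcal X(\rho)$ is an extremal vertex of $\mathcal X(\rho)$: for all points $y,z$ of (the geometric realisation of) $\mathcal X(\rho)$, if $x\in[yz]$, then $x=y$ or $x=z$. -/

import Mathlib

open scoped Pointwise

namespace StableLattice

section Lattices

variable (O K V : Type*) [CommRing O] [Field K] [Algebra O K]
  [AddCommGroup V] [Module K V] [Module O V] [IsScalarTower O K V]

/-- The lattices in `V`: finitely generated `O`-submodules of `V` that span `V` over `K`. When `O`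
is a discrete valuation ring with fraction field `K` and `V` is finite-dimensional, these are
exactly the free `O`-submodules of `V` of rank `dim_K V`. -/
abbrev Lattice : Type _ := {Λ : Submodule O V // Submodule.IsLattice K Λ}

/-- Two lattices are homothetic if one is `a` times the other for some `a` in `Kˣ`. -/
def homothety : Setoid (Lattice O K V) where
  r Λ₁ Λ₂ := ∃ a : Kˣ, Λ₂.1 = a • Λ₁.1
  iseqv :=
    { refl := fun Λ => ⟨1, (one_smul Kˣ Λ.1).symm⟩
      symm := by
        rintro Λ₁ Λ₂ ⟨a, h⟩
        exact ⟨a⁻¹, by rw [h, inv_smul_smul]⟩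
      trans := by
        rintro Λ₁ Λ₂ Λ₃ ⟨a, h⟩ ⟨b, h'⟩
        exact ⟨b * a, by rw [h', h, mul_smul]⟩ }

/-- The set `X(V)` of homothety classes of lattices: the vertices of the building. -/
def Vertex : Type _ := Quotient (homothety O K V)

variable {O K V}

/-- The homothety class of a lattice. -/
def Lattice.toVertex (Λ : Lattice O K V) : Vertex O K V := Quotient.mk (homothety O K V) Λ

/-- The Bruhat–Tits building of `PGL(V)` as an abstract simplicial complex on the homothety
classes of lattices. The vertices `x₀, …, xₙ` form a face if they have representatives with
`π Λₙ ⊊ Λ₀ ⊊ Λ₁ ⊊ ⋯ ⊊ Λₙ`. -/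
def building (π : O) : PreAbstractSimplicialComplex (Vertex O K V) where
  faces := {s | ∃ (n : ℕ) (Λ : Fin (n + 1) → Lattice O K V),
    (s : Set (Vertex O K V)) = Set.range (fun i => (Λ i).toVertex) ∧
    StrictMono Λ ∧ π • (Λ (Fin.last n)).1 < (Λ 0).1}
  isRelLowerSet_faces := by
    classical
    rintro s ⟨n, Λ, hs, hmono, hlt⟩
    refine ⟨?_, ?_⟩
    · rw [← Finset.coe_nonempty, hs]
      exact Set.range_nonempty _
    · intro t hts ht
      have hex : ∀ x : Vertex O K V, ∃ i, x ∈ t → (Λ i).toVertex = x := by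
        intro x
        by_cases hx : x ∈ t
        · have : x ∈ (s : Set (Vertex O K V)) := hts hx
          rw [hs] at this
          obtain ⟨i, hi⟩ := this
          exact ⟨i, fun _ => hi⟩
        · exact ⟨0, fun h => absurd h hx⟩
      choose f hf using hex
      have hpos : 0 < (t.image f).card := Finset.card_pos.mpr (ht.image f)
      obtain ⟨m, hm⟩ : ∃ m, (t.image f).card = m + 1 := ⟨_, (Nat.succ_pred_eq_of_pos hpos).symm⟩
      let e := (t.image f).orderEmbOfFin hm
      refine ⟨m, fun j => Λ (e j), ?_, hmono.comp e.strictMono, ?_⟩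
      · ext x
        constructor
        · intro hx
          have : f x ∈ Set.range e := by
            rw [Finset.range_orderEmbOfFin]
            exact Finset.mem_image_of_mem f hx
          obtain ⟨j, hj⟩ := this
          exact ⟨j, by simp only [hj]; exact hf x hx⟩
        · rintro ⟨j, rfl⟩
          have : e j ∈ t.image f := Finset.orderEmbOfFin_mem _ hm j
          obtain ⟨y, hy, hyj⟩ := Finset.mem_image.mp this
          simp only [← hyj, hf y hy]
          exact hy
      · refine lt_of_le_of_lt ?_ (lt_of_lt_of_le hlt ?_)
        · exact Submodule.map_mono (hmono.monotone (Fin.le_last _))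
        · exact hmono.monotone (Fin.zero_le _)

/-- The (closed) points of the geometric realisation of a simplicial complex, in barycentric
coordinates: weights `≥ 0` on the vertices, of total mass one, supported on a face. -/
def realization {α : Type*} (C : PreAbstractSimplicialComplex α) : Set (α →₀ ℝ) :=
  {p | (∀ x, 0 ≤ p x) ∧ (p.sum fun _ t => t) = 1 ∧ p.support ∈ C.faces}

/-- A vertex seen as a point of the geometric realisation. -/
noncomputable def vertexPoint {α : Type*} (x : α) : α →₀ ℝ := Finsupp.single x 1

/-- `x` is the class of the lattice with `O`-basis `π ^ n₁ v₁, …, π ^ n_d v_d`; so `x` is a vertex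
of the apartment associated to the basis `v` of `V`, with coordinates `n`. -/
def HasVertexCoords (π : O) {ι : Type*} (v : Module.Basis ι K V) (x : Vertex O K V)
    (n : ι → ℤ) : Prop :=
  ∃ Λ : Lattice O K V, Λ.toVertex = x ∧
    Λ.1 = Submodule.span O (Set.range fun i => (algebraMap O K π) ^ (n i) • v i)

/-- The point `p` of the realisation of the building lies in the realisation of the apartment
associated to the basis `v`, and the class of `c` modulo the line `ℝ(1,…,1)` is its position in the
Euclidean space `ℝ^d / ℝ(1,…,1)` with which this apartment is identified. A vertex has its integral
coordinates as its position (they are unique up to adding a constant), and positions are affine in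
the barycentric coordinates. -/
def HasApartmentCoords (π : O) {ι : Type*} (v : Module.Basis ι K V) (p : Vertex O K V →₀ ℝ)
    (c : ι → ℝ) : Prop :=
  ∃ n : Vertex O K V → ι → ℤ, (∀ x ∈ p.support, HasVertexCoords π v x (n x)) ∧
    ∃ k : ℝ, ∀ i, c i = (p.sum fun x t => t * (n x i : ℝ)) + k

/-- `p` lies on the geodesic `[yz]` of the building: the straight segment that joins `y` to `z` in
the Euclidean space given by an apartment that contains `y` and `z`. (Two points of the building
always lie in a common apartment, and the segment does not depend on it.) -/
def OnGeodesic (π : O) (y z p : Vertex O K V →₀ ℝ) : Prop :=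
  ∃ v : Module.Basis (Fin (Module.finrank K V)) K V, ∃ cy cz cp : Fin (Module.finrank K V) → ℝ,
    HasApartmentCoords π v y cy ∧ HasApartmentCoords π v z cz ∧ HasApartmentCoords π v p cp ∧
      cp ∈ segment ℝ cy cz

variable {G : Type*} [Group G]

/-- `ρ(G) Λ = Λ`. -/
def IsInvariant (ρ : Representation K G V) (Λ : Lattice O K V) : Prop :=
  ∀ g : G, Λ.1.map ((ρ g).restrictScalars O) = Λ.1

/-- The vertices of `X(ρ)`: those represented by an invariant lattice. -/
def IsInvariantVertex (ρ : Representation K G V) (x : Vertex O K V) : Prop :=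
  ∃ Λ : Lattice O K V, Λ.toVertex = x ∧ IsInvariant ρ Λ

/-- The full subcomplex `X(ρ)` of the building on the vertices represented by invariant lattices. -/
def invariantComplex (π : O) (ρ : Representation K G V) :
    PreAbstractSimplicialComplex (Vertex O K V) where
  faces := {s | s ∈ (building π : PreAbstractSimplicialComplex (Vertex O K V)).faces ∧
    ∀ x ∈ s, IsInvariantVertex ρ x}
  isRelLowerSet_faces := by
    rintro s ⟨hs, hinv⟩
    have h := (building (K := K) (V := V) π).isRelLowerSet_faces hs
    exact ⟨h.1, fun t hts ht => ⟨h.2 hts ht, fun x hx => hinv x (hts hx)⟩⟩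

/-- The point `p` of (the realisation of) `X(ρ)` is extremal in `X(ρ)`. -/
def IsExtremal (π : O) (ρ : Representation K G V) (p : Vertex O K V →₀ ℝ) : Prop :=
  p ∈ realization (invariantComplex π ρ) ∧
    ∀ y ∈ realization (invariantComplex π ρ), ∀ z ∈ realization (invariantComplex π ρ),
      OnGeodesic π y z p → p = y ∨ p = z

/-- `Λ` is normalised at `v`: `v` lies in `Λ` and has nonzero image in `Λ / π Λ`. -/
def IsNormalizedAt (π : O) (v : V) (Λ : Lattice O K V) : Prop :=
  v ∈ Λ.1 ∧ v ∉ π • Λ.1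

/-- `Λ` is a maximal element, for inclusion, of the set of all invariant lattices that are
normalised at `v`. -/
def IsMaximalAt (π : O) (ρ : Representation K G V) (v : V) (Λ : Lattice O K V) : Prop :=
  Maximal (fun Λ' : Lattice O K V => IsInvariant ρ Λ' ∧ IsNormalizedAt π v Λ') Λ

/-- A vertex is maximal if, for some nonzero `v`, it is represented by a lattice that is maximal
with respect to `v`. -/
def IsMaximalVertex (π : O) (ρ : Representation K G V) (x : Vertex O K V) : Prop :=
  ∃ v : V, v ≠ 0 ∧ ∃ Λ : Lattice O K V, Λ.toVertex = x ∧ IsMaximalAt π ρ v Λ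

end Lattices

end StableLattice

/-! Let `Λ` be maximal at `w`, with class `x`, and work in the apartment in which the geodesic is
given. There `Λ` is spanned by the `π ^ n i • v i`, and since `w ∉ π • Λ`, some coordinate `i₀` of
`w` is not divisible by `π ^ (n i₀ + 1)`. Scale an invariant lattice of the apartment until its
exponent at `i₀` is `n i₀`. Adding it to `Λ` leaves the `i₀` coordinate unchanged, so the sum is
invariant and still normalised at `w`; by maximality it equals `Λ`. Hence every invariant vertex of
the apartment, with coordinates `m`, satisfies `n i - n i₀ ≤ m i - m i₀` for all `i`
(`IsMaximalAt.sub_le_sub`).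

By averaging, all points of the invariant complex in this apartment lie in the same cone. It is
pointed with apex `x`, so a segment of the cone through `x` has an end at the position of `x`. That
end is `x` itself, because positions determine points at a vertex
(`HasApartmentCoords.eq_vertexPoint`). -/

namespace StableLattice

/-! ### Homothety, invariance and barycentric coordinates -/

section Homothety

variable {O K V G : Type*} [CommRing O] [Field K] [Algebra O K]
  [AddCommGroup V] [Module K V] [Module O V] [IsScalarTower O K V] [Group G]

theorem mem_units_smul {Λ : Submodule O V} {a : Kˣ} {w : V} :
    w ∈ a • Λ ↔ ∃ y ∈ Λ, a • y = w := Iff.rfl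

theorem toVertex_eq_iff {Λ₁ Λ₂ : Lattice O K V} :
    Λ₁.toVertex = Λ₂.toVertex ↔ ∃ a : Kˣ, Λ₂.1 = a • Λ₁.1 :=
  Quotient.eq (r := homothety O K V)

theorem IsInvariant.of_smul {ρ : Representation K G V} {Λ Λ' : Lattice O K V}
    (h : IsInvariant ρ Λ) {a : Kˣ} (ha : Λ'.1 = a • Λ.1) : IsInvariant ρ Λ' := by
  intro g
  rw [ha]
  conv_rhs => rw [← h g]
  ext w
  simp [Submodule.mem_smul_pointwise_iff_exists, Units.smul_def]

theorem IsInvariant.sup {ρ : Representation K G V} {Λ Λ' Λ'' : Lattice O K V}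
    (h : IsInvariant ρ Λ) (h' : IsInvariant ρ Λ') (hs : Λ''.1 = Λ.1 ⊔ Λ'.1) :
    IsInvariant ρ Λ'' := by
  intro g
  rw [hs, Submodule.map_sup, h g, h' g]

theorem IsInvariantVertex.isInvariant {ρ : Representation K G V} {x : Vertex O K V}
    (h : IsInvariantVertex ρ x) {Λ : Lattice O K V} (hΛ : Λ.toVertex = x) : IsInvariant ρ Λ := by
  obtain ⟨Λ', rfl, h'⟩ := h
  obtain ⟨a, ha⟩ := toVertex_eq_iff.1 hΛ.symm
  exact h'.of_smul ha

theorem realization_invariantComplex_subset {π : O} {ρ : Representation K G V} :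
    realization (invariantComplex π ρ) ⊆ realization (building (K := K) (V := V) π) :=
  fun _ hp => ⟨hp.1, hp.2.1, hp.2.2.1⟩

/-- Differences cancel the additive constant in a position, and total weight one lets any `e` move
inside the sum. Bounds on integral vertex coordinates thus pass to points. -/
theorem HasApartmentCoords.exists_sub_eq_sum {ι : Type*} {π : O} {v : Module.Basis ι K V} {p : Vertex O K V →₀ ℝ}
    {c : ι → ℝ} (hsum : (p.sum fun _ t => t) = 1) (h : HasApartmentCoords π v p c) :
    ∃ n : Vertex O K V → ι → ℤ, (∀ x ∈ p.support, HasVertexCoords π v x (n x)) ∧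
      ∀ (e : ℝ) (i j : ι), c i - c j - e = ∑ x ∈ p.support, p x * ((n x i - n x j : ℤ) - e) := by
  obtain ⟨n, hn, k, hk⟩ := h
  refine ⟨n, hn, fun e i j => ?_⟩
  have he : e = ∑ x ∈ p.support, p x * e := by
    rw [← Finset.sum_mul]
    change e = (p.sum fun _ t => t) * e
    rw [hsum, one_mul]
  simp only [mul_sub, Finset.sum_sub_distrib, Int.cast_sub]
  rw [← he, hk, hk]
  simp only [Finsupp.sum]
  ring

theorem eq_vertexPoint_of_support_subset {α : Type*} {p : α →₀ ℝ} {x : α}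
    (hsum : (p.sum fun _ t => t) = 1) (h : ∀ y ∈ p.support, y = x) : p = vertexPoint x := by
  have h1 : p.support ⊆ {x} := fun y hy => Finset.mem_singleton.2 (h y hy)
  obtain ⟨b, rfl⟩ := Finsupp.support_subset_singleton'.1 h1
  rw [Finsupp.sum_single_index rfl] at hsum
  rw [hsum, vertexPoint]

theorem IsMaximalAt.vertexPoint_mem {π : O} {ρ : Representation K G V} {w : V}
    {Λ : Lattice O K V} (hΛ : IsMaximalAt π ρ w Λ) :
    vertexPoint Λ.toVertex ∈ realization (invariantComplex π ρ) := by
  classical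
  refine ⟨fun y => ?_, ?_, ?_, ?_⟩
  · rw [vertexPoint, Finsupp.single_apply]
    split_ifs <;> norm_num
  · rw [vertexPoint, Finsupp.sum_single_index rfl]
  · refine ⟨0, fun _ => Λ, ?_, fun a b hab => absurd hab (by omega), ?_⟩
    · rw [vertexPoint, Finsupp.support_single _ one_ne_zero]
      simp
    -- The inclusion is strict because `w` lies in `Λ` but not in `π • Λ`.
    · refine lt_of_le_of_ne (Submodule.smul_le_self_of_tower π Λ.1) fun h => hΛ.prop.2.2 ?_
      rw [h]
      exact hΛ.prop.2.1
  · intro y hy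
    rw [vertexPoint, Finsupp.support_single _ one_ne_zero, Finset.mem_singleton] at hy
    exact ⟨Λ, hy.symm, hΛ.prop.1⟩

end Homothety

/-! ### Lattices and points of an apartment -/

section StandardLattice

variable {O K V : Type*} [CommRing O]
  [Field K] [Algebra O K] [IsFractionRing O K]
  [AddCommGroup V] [Module K V] [Module O V] [IsScalarTower O K V]
  {ι : Type*} [Finite ι] {π : O}

/-- The `O`-submodule of `V` with basis `π ^ n₁ v₁, …, π ^ n_d v_d`. -/
def standardLattice (π : O) (v : Module.Basis ι K V) (n : ι → ℤ) : Submodule O V :=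
  Submodule.span O (Set.range fun i => (algebraMap O K π) ^ (n i) • v i)

theorem algebraMap_uniformizer_ne_zero (hπ : Irreducible π) : algebraMap O K π ≠ 0 := by
  simpa using hπ.ne_zero

theorem isInteger_zpow_iff (hπ : Irreducible π) (k : ℤ) :
    IsLocalization.IsInteger O ((algebraMap O K π) ^ k) ↔ 0 ≤ k := by
  have h0 := algebraMap_uniformizer_ne_zero (K := K) hπ
  constructor
  · rintro ⟨r, hr⟩
    by_contra! hk
    obtain ⟨m, rfl⟩ : ∃ m : ℕ, k = -(m + 1 : ℕ) := ⟨(-k - 1).toNat, by omega⟩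
    rw [zpow_neg, zpow_natCast, ← one_div, eq_div_iff (pow_ne_zero _ h0), ← map_pow, ← map_mul,
      ← map_one (algebraMap O K)] at hr
    have h1 := IsFractionRing.injective O K hr
    exact hπ.not_isUnit (IsUnit.of_mul_eq_one (r * π ^ m) (by rw [← h1]; ring))
  · intro hk
    obtain ⟨m, rfl⟩ := Int.eq_ofNat_of_zero_le hk
    exact ⟨π ^ m, by simp⟩

/-- Makes inclusion and normalisation conditions on each coordinate separately. -/
theorem mem_standardLattice (hπ : Irreducible π) (v : Module.Basis ι K V) (n : ι → ℤ) (w : V) :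
    w ∈ standardLattice π v n ↔
      ∀ i, IsLocalization.IsInteger O (v.repr w i * (algebraMap O K π) ^ (-n i)) := by
  have h0 := algebraMap_uniformizer_ne_zero (K := K) hπ
  have := Fintype.ofFinite ι
  constructor
  · intro hw i
    induction hw using Submodule.span_induction with
    | mem x hx =>
      classical
      obtain ⟨j, rfl⟩ := hx
      by_cases h : j = i
      · subst h
        exact ⟨1, by simp [zpow_neg, mul_inv_cancel₀ (zpow_ne_zero (n j) h0)]⟩
      · exact ⟨0, by simp [h]⟩
    | zero => exact ⟨0, by simp⟩
    | add x y _ _ hx hy =>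
      simpa [add_mul] using IsLocalization.isInteger_add hx hy
    | smul a x _ hx =>
      have := IsLocalization.isInteger_smul (a := a) hx
      rwa [← algebraMap_smul K a x, map_smul, Finsupp.smul_apply, smul_eq_mul, mul_assoc,
        ← Algebra.smul_def]
  · intro h
    choose r hr using h
    rw [← v.sum_repr w]
    refine Submodule.sum_mem _ fun i _ => ?_
    have : v.repr w i • v i = r i • ((algebraMap O K π) ^ (n i) • v i) := by
      rw [← algebraMap_smul K (r i), hr, smul_smul, mul_assoc, ← zpow_add₀ h0]
      simp
    rw [this]
    exact Submodule.smul_mem _ _ (Submodule.subset_span ⟨i, rfl⟩)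

theorem standardLattice_le_iff (hπ : Irreducible π) (v : Module.Basis ι K V) (n m : ι → ℤ) :
    standardLattice π v n ≤ standardLattice π v m ↔ ∀ i, m i ≤ n i := by
  classical
  have h0 := algebraMap_uniformizer_ne_zero (K := K) hπ
  have key : ∀ i, (algebraMap O K π) ^ (n i) • v i ∈ standardLattice π v m ↔ m i ≤ n i := by
    intro i
    rw [mem_standardLattice hπ, ← sub_nonneg, ← isInteger_zpow_iff (K := K) hπ]
    constructor
    · intro h
      simpa [sub_eq_add_neg, zpow_add₀ h0] using h i
    · intro h j
      by_cases hij : i = j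
      · subst hij
        simpa [sub_eq_add_neg, zpow_add₀ h0] using h
      · exact ⟨0, by simp [hij]⟩
  rw [standardLattice, Submodule.span_le, Set.range_subset_iff]
  exact forall_congr' key

theorem smul_standardLattice (hπ : Irreducible π) (v : Module.Basis ι K V) (n : ι → ℤ) {a : Kˣ}
    {u : Oˣ} {k : ℤ} (ha : (a : K) = algebraMap O K u * (algebraMap O K π) ^ k) :
    a • standardLattice π v n = standardLattice π v (fun i => n i + k) := by
  have h0 := algebraMap_uniformizer_ne_zero (K := K) hπ
  have hu : IsUnit (algebraMap O K u) := u.isUnit.map _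
  ext w
  rw [mem_units_smul]
  constructor
  · rintro ⟨w, hw, rfl⟩
    rw [mem_standardLattice hπ] at hw ⊢
    intro i
    have := IsLocalization.isInteger_smul (a := (u : O)) (hw i)
    convert this using 1
    rw [Units.smul_def, map_smul, Finsupp.smul_apply, smul_eq_mul, ha, Algebra.smul_def, neg_add,
      zpow_add₀ h0, zpow_neg _ k]
    field_simp
  · intro hw
    refine ⟨a⁻¹ • w, ?_, smul_inv_smul a w⟩
    rw [mem_standardLattice hπ] at hw ⊢
    intro i
    have := IsLocalization.isInteger_smul (a := ((u⁻¹ : Oˣ) : O)) (hw i)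
    convert this using 1
    have hu' : algebraMap O K ((u⁻¹ : Oˣ) : O) = (algebraMap O K u)⁻¹ :=
      eq_inv_of_mul_eq_one_left (by rw [← map_mul, Units.inv_mul, map_one])
    rw [Units.smul_def, map_smul, Finsupp.smul_apply, smul_eq_mul, Units.val_inv_eq_inv_val, ha,
      Algebra.smul_def, neg_add, zpow_add₀ h0, zpow_neg _ k, hu', mul_inv]
    ring

theorem uniformizer_smul_eq (hπ : Irreducible π) (Λ : Submodule O V) :
    π • Λ = Units.mk0 (algebraMap O K π) (algebraMap_uniformizer_ne_zero hπ) • Λ := by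
  ext w
  simp [Submodule.mem_smul_pointwise_iff_exists, Units.smul_def]

theorem uniformizer_smul_standardLattice (hπ : Irreducible π) (v : Module.Basis ι K V)
    (n : ι → ℤ) : π • standardLattice π v n = standardLattice π v (fun i => n i + 1) := by
  rw [uniformizer_smul_eq (K := K) hπ]
  exact smul_standardLattice hπ v n (u := 1) (k := 1) (by simp)

theorem exists_smul_standardLattice (hπ : Irreducible π) (v : Module.Basis ι K V) (n : ι → ℤ)
    (k : ℤ) : ∃ a : Kˣ, a • standardLattice π v n = standardLattice π v (fun i => n i + k) :=
  ⟨Units.mk0 _ (zpow_ne_zero k (algebraMap_uniformizer_ne_zero hπ)),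
    smul_standardLattice hπ v n (u := 1) (k := k) (by simp)⟩

/-- A vertex of an apartment is determined by the differences of its coordinates. -/
theorem HasVertexCoords.eq_of_sub_eq (hπ : Irreducible π) {v : Module.Basis ι K V}
    {x y : Vertex O K V} {n m : ι → ℤ} (hx : HasVertexCoords π v x n)
    (hy : HasVertexCoords π v y m) (i₀ : ι) (h : ∀ i, m i - m i₀ = n i - n i₀) : y = x := by
  obtain ⟨Λ, rfl, hΛ⟩ := hx
  obtain ⟨Λ', rfl, hΛ'⟩ := hy
  obtain ⟨a, ha⟩ := exists_smul_standardLattice hπ v m (n i₀ - m i₀)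
  refine toVertex_eq_iff.2 ⟨a, ?_⟩
  rw [hΛ, hΛ']
  refine Eq.trans ?_ ha.symm
  change standardLattice π v n = _
  congr 1
  funext i
  linarith [h i]

variable [IsDomain O] [IsDiscreteValuationRing O]

theorem exists_isUnit_zpow (hπ : Irreducible π) (a : Kˣ) :
    ∃ (u : Oˣ) (k : ℤ), (a : K) = algebraMap O K u * (algebraMap O K π) ^ k := by
  obtain ⟨k, u, h⟩ :=
    IsDiscreteValuationRing.exists_units_eq_smul_zpow_of_irreducible hπ a.ne_zero
  exact ⟨u, k, by rw [h, Units.smul_def, Algebra.smul_def]⟩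

/-- A scalar is a unit times a power of `π`, and the unit does not change the lattice. -/
theorem HasVertexCoords.exists_eq_standardLattice (hπ : Irreducible π) {v : Module.Basis ι K V}
    {x : Vertex O K V} {n : ι → ℤ} (h : HasVertexCoords π v x n) {Λ : Lattice O K V}
    (hΛ : Λ.toVertex = x) : ∃ k : ℤ, Λ.1 = standardLattice π v (fun i => n i + k) := by
  obtain ⟨Λ', rfl, h'⟩ := h
  obtain ⟨a, ha⟩ := Quotient.exact hΛ.symm
  obtain ⟨u, k, hk⟩ := exists_isUnit_zpow hπ a
  exact ⟨k, by rw [ha, h']; exact smul_standardLattice hπ v n hk⟩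

/-- Along a face of the building, the differences of two coordinates vary by at most one. -/
theorem HasVertexCoords.sub_le_sub_add_one (hπ : Irreducible π) {v : Module.Basis ι K V}
    {s : Finset (Vertex O K V)}
    (hs : s ∈ (building π : PreAbstractSimplicialComplex (Vertex O K V)).faces)
    {x y : Vertex O K V} (hxs : x ∈ s) (hys : y ∈ s) {n m : ι → ℤ}
    (hx : HasVertexCoords π v x n) (hy : HasVertexCoords π v y m) (i j : ι) :
    m i - m j ≤ n i - n j + 1 := by
  obtain ⟨N, Λ, hr, hmono, hlt⟩ := hs
  rw [← Finset.mem_coe, hr] at hxs hys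
  obtain ⟨a, ha⟩ := hxs
  obtain ⟨b, hb⟩ := hys
  obtain ⟨k, hk⟩ := hx.exists_eq_standardLattice hπ ha
  obtain ⟨l, hl⟩ := hy.exists_eq_standardLattice hπ hb
  -- `π Λ_a ⊆ π Λ_N ⊆ Λ_0 ⊆ Λ_b`, whatever the order of `a` and `b`.
  have key : ∀ a b : Fin (N + 1), π • (Λ a).1 ≤ (Λ b).1 := fun a b =>
    (Submodule.map_mono (hmono.monotone (Fin.le_last a))).trans
      (hlt.le.trans (hmono.monotone (Fin.zero_le b)))
  have h1 := key a b
  have h2 := key b a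
  rw [hk, hl, uniformizer_smul_standardLattice hπ, standardLattice_le_iff hπ] at h1 h2
  rcases le_total a b with hab | hab
  · have h3 : (Λ a).1 ≤ (Λ b).1 := hmono.monotone hab
    rw [hk, hl, standardLattice_le_iff hπ] at h3
    linarith [h3 i, h2 j]
  · have h3 : (Λ b).1 ≤ (Λ a).1 := hmono.monotone hab
    rw [hk, hl, standardLattice_le_iff hπ] at h3
    linarith [h3 j, h1 i]

/-- A point of an apartment with the same position as a vertex of that apartment is that vertex. -/
theorem HasApartmentCoords.eq_vertexPoint (hπ : Irreducible π) {v : Module.Basis ι K V}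
    {p : Vertex O K V →₀ ℝ} (hp : p ∈ realization (building (K := K) (V := V) π))
    {c : ι → ℝ} (hc : HasApartmentCoords π v p c) {x : Vertex O K V} {n : ι → ℤ}
    (hx : HasVertexCoords π v x n) (i₀ : ι) (h : ∀ i, c i - c i₀ = n i - n i₀) :
    p = vertexPoint x := by
  obtain ⟨hpos, hsum, hface⟩ := hp
  obtain ⟨m, hm, hmc⟩ := hc.exists_sub_eq_sum hsum
  refine eq_vertexPoint_of_support_subset hsum fun y hy =>
    hx.eq_of_sub_eq hπ (hm y hy) i₀ fun i => ?_
  have hpy : 0 < p y := lt_of_le_of_ne (hpos y) (Finsupp.mem_support_iff.1 hy).symm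
  -- The integral deviations from the vertex `x` have weighted mean zero. On a face they differ by
  -- at most one, so they cannot take both signs; with positive weights, all of them vanish.
  have h0 : ∑ z ∈ p.support, p z * (((m z i - m z i₀ - (n i - n i₀) : ℤ)) : ℝ) = 0 := by
    have := hmc (n i - n i₀ : ℤ) i i₀
    rw [h i] at this
    push_cast at this ⊢
    linarith
  have hle : ∀ z ∈ p.support, m z i - m z i₀ ≤ m y i - m y i₀ + 1 := fun z hz =>
    HasVertexCoords.sub_le_sub_add_one hπ hface hy hz (hm y hy) (hm z hz) i i₀
  have hge : ∀ z ∈ p.support, m y i - m y i₀ ≤ m z i - m z i₀ + 1 := fun z hz =>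
    HasVertexCoords.sub_le_sub_add_one hπ hface hz hy (hm z hz) (hm y hy) i i₀
  rcases lt_trichotomy (m y i - m y i₀) (n i - n i₀) with hlt | heq | hgt
  · have hnp : ∀ z ∈ p.support, p z * (((m z i - m z i₀ - (n i - n i₀) : ℤ)) : ℝ) ≤ 0 :=
      fun z hz => mul_nonpos_of_nonneg_of_nonpos (hpos z)
        (Int.cast_nonpos.2 (by have := hle z hz; omega))
    have := (Finset.sum_eq_zero_iff_of_nonpos hnp).1 h0 y hy
    have := (mul_eq_zero.1 this).resolve_left hpy.ne'
    rw [Int.cast_eq_zero] at this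
    omega
  · exact heq
  · have hnp : ∀ z ∈ p.support, 0 ≤ p z * (((m z i - m z i₀ - (n i - n i₀) : ℤ)) : ℝ) :=
      fun z hz => mul_nonneg (hpos z) (Int.cast_nonneg (by have := hge z hz; omega))
    have := (Finset.sum_eq_zero_iff_of_nonneg hnp).1 h0 y hy
    have := (mul_eq_zero.1 this).resolve_left hpy.ne'
    rw [Int.cast_eq_zero] at this
    omega

end StandardLattice

/-! ### The cone at a maximal lattice -/

section Maximal

variable {O K V G : Type*} [CommRing O]
  [Field K] [Algebra O K] [IsFractionRing O K]
  [AddCommGroup V] [Module K V] [Module O V] [IsScalarTower O K V] [Group G]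
  {ι : Type*} [Finite ι] {π : O} {ρ : Representation K G V}

/-- Invariant vertices of an apartment that contains a maximal lattice `Λ` lie in a cone with apex
the class of `Λ`. -/
theorem IsMaximalAt.sub_le_sub (hπ : Irreducible π) {v : Module.Basis ι K V} {w : V}
    {Λ : Lattice O K V} (hΛ : IsMaximalAt π ρ w Λ) {n : ι → ℤ}
    (hn : Λ.1 = standardLattice π v n) {i₀ : ι}
    (hi₀ : ¬ IsLocalization.IsInteger O (v.repr w i₀ * (algebraMap O K π) ^ (-(n i₀ + 1))))
    {y : Vertex O K V} (hy : IsInvariantVertex ρ y) {m : ι → ℤ} (hm : HasVertexCoords π v y m)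
    (i : ι) : n i - n i₀ ≤ m i - m i₀ := by
  obtain ⟨Λ₁, rfl, h₁⟩ := hm
  -- This shift makes the exponent at `i₀` equal to `n i₀`.
  obtain ⟨a, ha⟩ := exists_smul_standardLattice hπ v m (n i₀ - m i₀)
  have : Submodule.IsLattice K Λ.1 := Λ.2
  have : Submodule.IsLattice K Λ₁.1 := Λ₁.2
  let Λ₂ : Lattice O K V := ⟨a • Λ₁.1, inferInstance⟩
  have h₂ : Λ₂.1 = standardLattice π v (fun i => m i + (n i₀ - m i₀)) := by
    rw [← ha]
    exact congrArg (a • ·) h₁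
  have : Submodule.IsLattice K Λ₂.1 := Λ₂.2
  let Λ₃ : Lattice O K V := ⟨Λ.1 ⊔ Λ₂.1, inferInstance⟩
  have hinv : IsInvariant ρ Λ₃ :=
    IsInvariant.sup hΛ.prop.1 ((hy.isInvariant rfl).of_smul (Λ' := Λ₂) rfl) rfl
  have hle : Λ.1 ≤ Λ₃.1 := le_sup_left
  have hle' : Λ₃.1 ≤ standardLattice π v (fun i => min (n i) (m i + (n i₀ - m i₀))) := by
    refine sup_le ?_ ?_
    · rw [hn, standardLattice_le_iff hπ]
      exact fun i => min_le_left _ _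
    · rw [h₂, standardLattice_le_iff hπ]
      exact fun i => min_le_right _ _
  have hnorm : IsNormalizedAt π w Λ₃ := by
    refine ⟨hle hΛ.prop.2.1, fun hw => hi₀ ?_⟩
    -- At `i₀` the minimum is `n i₀`, so `w ∈ π • Λ₃` would contradict the choice of `i₀`.
    have := Submodule.map_mono hle' hw
    change w ∈ π • standardLattice π v _ at this
    rw [uniformizer_smul_standardLattice hπ, mem_standardLattice hπ] at this
    simpa using this i₀
  have hge : Λ₂.1 ≤ Λ.1 := le_sup_right.trans (hΛ.le_of_ge ⟨hinv, hnorm⟩ hle)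
  rw [h₂, hn, standardLattice_le_iff hπ] at hge
  linarith [hge i]

/-- The cone is convex and contains the vertices of the face that supports `p`. -/
theorem IsMaximalAt.sub_le_sub_of_mem_realization (hπ : Irreducible π) {v : Module.Basis ι K V}
    {w : V} {Λ : Lattice O K V} (hΛ : IsMaximalAt π ρ w Λ) {n : ι → ℤ}
    (hn : Λ.1 = standardLattice π v n) {i₀ : ι}
    (hi₀ : ¬ IsLocalization.IsInteger O (v.repr w i₀ * (algebraMap O K π) ^ (-(n i₀ + 1))))
    {p : Vertex O K V →₀ ℝ} (hp : p ∈ realization (invariantComplex π ρ)) {c : ι → ℝ}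
    (hc : HasApartmentCoords π v p c) (i : ι) : (n i - n i₀ : ℝ) ≤ c i - c i₀ := by
  obtain ⟨hpos, hsum, hface⟩ := hp
  obtain ⟨m, hm, hmc⟩ := hc.exists_sub_eq_sum hsum
  rw [← sub_nonneg, hmc]
  refine Finset.sum_nonneg fun y hy => mul_nonneg (hpos y) (sub_nonneg.2 ?_)
  exact_mod_cast hΛ.sub_le_sub hπ hn hi₀ (hface.2 y hy) (hm y hy) i

/-- A vertex represented by a maximal lattice is extremal. -/
theorem IsMaximalAt.isExtremal [IsDomain O] [IsDiscreteValuationRing O]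
    [FiniteDimensional K V] (hπ : Irreducible π) {w : V}
    {Λ : Lattice O K V} (hΛ : IsMaximalAt π ρ w Λ) :
    IsExtremal π ρ (vertexPoint Λ.toVertex) := by
  refine ⟨hΛ.vertexPoint_mem, fun y hy z hz hgeod => ?_⟩
  obtain ⟨v, cy, cz, cp, hcy, hcz, ⟨m, hm, k, hk⟩, s, t, hs, ht, hst, hcp⟩ := hgeod
  have hx : HasVertexCoords π v Λ.toVertex (m Λ.toVertex) := hm _ (by simp [vertexPoint])
  obtain ⟨l, hl⟩ := hx.exists_eq_standardLattice hπ rfl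
  have hnorm := hΛ.prop.2.2
  rw [hl, uniformizer_smul_standardLattice hπ, mem_standardLattice hπ, not_forall] at hnorm
  obtain ⟨i₀, hi₀⟩ := hnorm
  have hcp' : ∀ i, s * cy i + t * cz i = m Λ.toVertex i + k := by
    intro i
    rw [show s * cy i + t * cz i = cp i from congrFun hcp i, hk, vertexPoint,
      Finsupp.sum_single_index (by simp), one_mul]
  have hYle := hΛ.sub_le_sub_of_mem_realization hπ hl hi₀ hy hcy
  have hZle := hΛ.sub_le_sub_of_mem_realization hπ hl hi₀ hz hcz
  obtain rfl : t = 1 - s := by linarith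
  by_cases hs0 : s = 0
  · right
    subst hs0
    refine (hcz.eq_vertexPoint hπ (realization_invariantComplex_subset hz) hx i₀ fun i => ?_).symm
    linarith [hcp' i, hcp' i₀]
  · left
    refine (hcy.eq_vertexPoint hπ (realization_invariantComplex_subset hy) hx i₀ fun i => ?_).symm
    have hY := hYle i
    have hZ := hZle i
    push_cast at hY hZ
    have hs' : 0 < s := lt_of_le_of_ne hs (Ne.symm hs0)
    -- The excesses of `y` and `z` over `x` in the difference `i - i₀` are nonnegative, and their
    -- mean with weights `s` and `1 - s` is zero. As `s > 0`, that of `y` is zero.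
    refine le_antisymm ?_ (by linarith)
    refine le_of_mul_le_mul_left ?_ hs'
    have := mul_le_mul_of_nonneg_left hZ ht
    linarith [hcp' i, hcp' i₀]

end Maximal

end StableLattice

theorem mainTheorem10 {O K V G : Type*}
    [CommRing O] [IsDomain O] [IsDiscreteValuationRing O]
    [IsAdicComplete (IsLocalRing.maximalIdeal O) O]
    [Field K] [Algebra O K] [IsFractionRing O K]
    [AddCommGroup V] [Module K V] [Module O V] [IsScalarTower O K V] [FiniteDimensional K V]
    [Group G] (π : O) (hπ : Irreducible π) (ρ : Representation K G V)
    (x : StableLattice.Vertex O K V) (hx : StableLattice.IsMaximalVertex π ρ x) :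
    StableLattice.IsExtremal π ρ (StableLattice.vertexPoint x) := by
  obtain ⟨v, -, Λ, rfl, hΛ⟩ := hx
  exact hΛ.isExtremal hπ
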